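/- Let $Q=(q_{ij})$ be an $\ell\times\ell$ matrix with entries in $\{0,1\}$, let $\Sigma=\{(x_n)_{n\in\mathbb Z}\in\{1,\dots,\ell\}^{\mathbb Z} : q_{x_n x_{n+1}}=1 \text{ for all } n\in\mathbb Z\}$ be the associated two-sided subshift of finite type, let $\sigma\colon\Sigma\to\Sigma$, $(\sigma x)_n=x_{n+1}$, be the left shift, and let $\mu$ be an ergodic $\sigma$-invariant Borel probability measure on $\Sigma$. Let $A\colon\Sigma\to\operatorname{GL}(d,\mathbb R)$ be a Borel measurable map such that $\log\|A\|$ and $\log\|A^{-1}\|$ are $\mu$-integrable (for instance, $A$ continuous), where $\|\cdot\|$ is the Euclidean operator norm. For $n\ge 1$ write $A^n(x)=A(\sigma^{n-1}x)\cdots A(\sigma x)A(x)$ and $A^{-n}(x)=A(\sigma^{-n}x)^{-1}\cdots A(\sigma^{-1}x)^{-1}$, and put $$\lambda_+(\mu)=\inf_{n\ge1}\frac1n\int_\Sigma\log\|A^n\|\,d\mu,\qquad \lambda_-(\mu)=\sup_{n\ge1}\frac1n\int_\Sigma\log\|A^{-n}\|^{-1}\,d\mu .$$ A set $H\subset\operatorname{GL}(d,\mathbb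 R)$ is a *Zimmer block of exponent $\lambda$* if there are integers $d_1,\dots,d_k\ge 1$ with $d_1+\dots+d_k=d$ and compact subgroups $K_i\subset\operatorname{GL}(d_i,\mathbb R)$ such that $H$ is the set of all block upper triangular matrices with diagonal blocks $e^{\lambda}M_1,\dots,e^{\lambda}M_k$, where $M_i\in K_i$ for each $i$ (and the entries above the diagonal blocks are arbitrary). Suppose that there are a Zimmer block $U$ of exponent $0$ and a $\mu$-measurable map $\alpha\colon\Sigma\to\operatorname{SL}(d,\mathbb R)$ with $\alpha(\sigma x)A(x)\alpha(x)^{-1}\in U$ for $\mu$-almost every $x$. Then $$\lambda_+(\mu)=-\lambda_-(\mu)=0 .$$ -/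

import Mathlib

open MeasureTheory Filter Matrix
open scoped MatrixGroups

noncomputable section

/-- The two-sided subshift of finite type with transition matrix `Q`. Its σ-algebra is the one
induced from the product σ-algebra on `ℤ → Fin ℓ`, which is the Borel σ-algebra. -/
def SFT {ℓ : ℕ} (Q : Matrix (Fin ℓ) (Fin ℓ) ℕ) : Set (ℤ → Fin ℓ) :=
  {x | ∀ n : ℤ, Q (x n) (x (n + 1)) = 1}

/-- The left shift `(x_n) ↦ (x_{n+1})`, as a bijection of the subshift. -/
def leftShift {ℓ : ℕ} (Q : Matrix (Fin ℓ) (Fin ℓ) ℕ) : Equiv.Perm (SFT Q) where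
  toFun x := ⟨fun n => x.1 (n + 1), fun n => x.2 (n + 1)⟩
  invFun x := ⟨fun n => x.1 (n - 1), fun n => by
    have h := x.2 (n - 1)
    have e : n - 1 + 1 = n + 1 - 1 := by ring
    rw [e] at h
    exact h⟩
  left_inv x := by
    apply Subtype.ext
    funext n
    simp
  right_inv x := by
    apply Subtype.ext
    funext n
    simp

/-- `A(T^{n-1} x) ⋯ A(T x) A(x)`. -/
def forwardProduct {X G : Type*} [Group G] (T : Equiv.Perm X) (A : X → G) : ℕ → X → G
  | 0, _ => 1
  | n + 1, x => A ((T ^ n) x) * forwardProduct T A n x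

/-- `A(T^{-n} x)⁻¹ ⋯ A(T^{-1} x)⁻¹`. -/
def backwardProduct {X G : Type*} [Group G] (T : Equiv.Perm X) (A : X → G) : ℕ → X → G
  | 0, _ => 1
  | n + 1, x => (A ((T ^ (-((n : ℤ) + 1))) x))⁻¹ * backwardProduct T A n x

/-- The cocycle over `T` generated by `A`; `cocycle T A n x` is `Aⁿ(x)`, for `n ∈ ℤ`. -/
def cocycle {X G : Type*} [Group G] (T : Equiv.Perm X) (A : X → G) : ℤ → X → G
  | Int.ofNat n => forwardProduct T A n
  | Int.negSucc n => backwardProduct T A (n + 1)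

/-- The operator norm of a matrix with respect to the Euclidean norm on `ℝ^d`. -/
def opNorm {d : ℕ} (M : GL (Fin d) ℝ) : ℝ :=
  ‖Matrix.toEuclideanCLM (n := Fin d) (𝕜 := ℝ) (M : Matrix (Fin d) (Fin d) ℝ)‖

/-- `λ₊(μ) = inf_{n ≥ 1} (1/n) ∫ log ‖Aⁿ‖ dμ`, the infimum being taken in `[-∞, ∞]`. -/
def lyapunovPlus {X : Type*} [MeasurableSpace X] {d : ℕ} (T : Equiv.Perm X)
    (A : X → GL (Fin d) ℝ) (μ : Measure X) : EReal :=
  ⨅ (n : ℕ) (_ : 1 ≤ n),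
    (((1 / (n : ℝ)) * ∫ x, Real.log (opNorm (cocycle T A (n : ℤ) x)) ∂μ : ℝ) : EReal)

/-- `λ₋(μ) = sup_{n ≥ 1} (1/n) ∫ log ‖A⁻ⁿ‖⁻¹ dμ`, the supremum being taken in `[-∞, ∞]`. -/
def lyapunovMinus {X : Type*} [MeasurableSpace X] {d : ℕ} (T : Equiv.Perm X)
    (A : X → GL (Fin d) ℝ) (μ : Measure X) : EReal :=
  ⨆ (n : ℕ) (_ : 1 ≤ n),
    (((1 / (n : ℝ)) * ∫ x, Real.log ((opNorm (cocycle T A (-(n : ℤ)) x))⁻¹) ∂μ : ℝ) : EReal)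

/-- A Zimmer block of exponent `lam`. The indices `0, …, d-1` are cut into `k` consecutive nonempty
intervals, the fibres of the monotone surjection `b`; `K i` is a compact subgroup of the general
linear group of the `i`-th interval; and `H` is the set of all block upper triangular matrices
whose `i`-th diagonal block lies in `e^lam K i` for each `i`. -/
def IsZimmerBlock {d : ℕ} (lam : ℝ) (H : Set (GL (Fin d) ℝ)) : Prop :=
  ∃ (k : ℕ) (b : Fin d → Fin k) (K : (i : Fin k) → Subgroup (GL {a : Fin d // b a = i} ℝ)),
    Monotone b ∧ Function.Surjective b ∧
    (∀ i, IsCompact (K i : Set (GL {a : Fin d // b a = i} ℝ))) ∧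
    H = {M : GL (Fin d) ℝ |
      (M : Matrix (Fin d) (Fin d) ℝ).BlockTriangular b ∧
      ∀ i, ∃ N ∈ K i, (M : Matrix (Fin d) (Fin d) ℝ).toSquareBlock b i =
        Real.exp lam • (N : Matrix {a : Fin d // b a = i} {a : Fin d // b a = i} ℝ)}

end

/-!
The cocycle `A` is measurably conjugate, by `α`, to a cocycle `u` of block triangular matrices whose
diagonal blocks stay in compact groups. The diagonal blocks therefore do not grow, but neither `α`
nor the blocks of `u` above the diagonal are assumed integrable, so the conjugacy alone does not
control the growth of `A`. Integrability is recovered by replacing `α(x)⁻¹` with the orthogonal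
factor `O(x)` of its QR decomposition. The conjugate cocycle
`B n x = O(T^n x)ᵀ * Aⁿ(x) * O(x)` is still block triangular, it has the norms of `A` up to a constant
factor, and it equals `R(T^n x) * u n x * R(x)⁻¹` with `R = Oᵀ * α⁻¹` upper triangular.

Two facts then bound the growth from above.
* Conjugation by the constant diagonal matrices with entries `t ^ b i` does not affect growth rates,
  and as `t → 0` it contracts a block triangular matrix to its block diagonal part. By dominated
  convergence, for each fixed `N` the growth rate of `B` is at most the mean of
  `(1/N) log ‖blockDiagPart (B N)‖` (`exists_integral_log_entrySum_le_blockDiagPart`).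
* `log ‖blockDiagPart (B N x)‖` is at most a function of `T^N x` plus a function of `x`, both finite
  almost everywhere, so it is `o(N)` in measure by invariance of `μ`. It is also at most a constant
  plus the Birkhoff sum of the integrable function `log ‖A‖`, which upgrades convergence in measure
  to convergence of the means (`exists_integral_le_of_birkhoff_bound`).

From below, `|det A| = 1` almost everywhere, so `‖Aⁿ‖ ≥ 1`. The same argument for the inverse cocycle
over `T⁻¹` gives the other exponent.

Norms are mostly measured by the sum of the absolute values of the entries (`entrySum`), which is
visibly measurable and monotone in the entries; the constants relating it to the operator norm
disappear after division by `n`.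
-/

/-! ### The entrywise `ℓ¹` norm -/

/-- The sum of the absolute values of the entries of a square matrix. This norm is
submultiplicative, monotone in the absolute values of the entries, and equivalent to the Euclidean
operator norm. -/
noncomputable def entrySum {d : ℕ} (M : Matrix (Fin d) (Fin d) ℝ) : ℝ := ∑ i, ∑ j, |M i j|

theorem entrySum_nonneg {d : ℕ} (M : Matrix (Fin d) (Fin d) ℝ) : 0 ≤ entrySum M :=
  Finset.sum_nonneg fun _ _ => Finset.sum_nonneg fun _ _ => abs_nonneg _

theorem entrySum_mono {d : ℕ} {M N : Matrix (Fin d) (Fin d) ℝ} (h : ∀ i j, |M i j| ≤ |N i j|) :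
    entrySum M ≤ entrySum N :=
  Finset.sum_le_sum fun i _ => Finset.sum_le_sum fun j _ => h i j

theorem entrySum_le_of_abs_le {d : ℕ} {M : Matrix (Fin d) (Fin d) ℝ} {c : ℝ}
    (h : ∀ i j, |M i j| ≤ c) : entrySum M ≤ d * (d * c) := by
  calc entrySum M ≤ ∑ _i : Fin d, ∑ _j : Fin d, c :=
        Finset.sum_le_sum fun i _ => Finset.sum_le_sum fun j _ => h i j
    _ = d * (d * c) := by simp

theorem entrySum_mul_le {d : ℕ} (M N : Matrix (Fin d) (Fin d) ℝ) :
    entrySum (M * N) ≤ entrySum M * entrySum N := by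
  calc entrySum (M * N) ≤ ∑ i, ∑ j, ∑ k, |M i k| * |N k j| := by
        refine Finset.sum_le_sum fun i _ => Finset.sum_le_sum fun j _ => ?_
        rw [Matrix.mul_apply]
        exact (Finset.abs_sum_le_sum_abs _ _).trans (by simp [abs_mul])
    _ = ∑ i, ∑ k, |M i k| * ∑ j, |N k j| := by
        refine Finset.sum_congr rfl fun i _ => ?_
        rw [Finset.sum_comm]
        simp [Finset.mul_sum]
    _ ≤ ∑ i, ∑ k, |M i k| * entrySum N := by
        refine Finset.sum_le_sum fun i _ => Finset.sum_le_sum fun k _ => ?_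
        exact mul_le_mul_of_nonneg_left (Finset.single_le_sum (f := fun i => ∑ j, |N i j|)
          (fun _ _ => Finset.sum_nonneg fun _ _ => abs_nonneg _) (Finset.mem_univ k))
          (abs_nonneg _)
    _ = entrySum M * entrySum N := by
        simp [entrySum, Finset.sum_mul]

theorem continuous_entrySum {d : ℕ} :
    Continuous (entrySum : Matrix (Fin d) (Fin d) ℝ → ℝ) := by
  unfold entrySum
  fun_prop

theorem abs_apply_le_opNorm {d : ℕ} (M : GL (Fin d) ℝ) (i j : Fin d) :
    |(M : Matrix (Fin d) (Fin d) ℝ) i j| ≤ opNorm M := by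
  have h := (Matrix.toEuclideanCLM (n := Fin d) (𝕜 := ℝ) (M : Matrix (Fin d) (Fin d) ℝ)).le_opNorm
    (EuclideanSpace.single j 1)
  have h2 := PiLp.norm_apply_le (Matrix.toEuclideanCLM (n := Fin d) (𝕜 := ℝ)
    (M : Matrix (Fin d) (Fin d) ℝ) (EuclideanSpace.single j 1)) i
  simp only [PiLp.norm_single, norm_one, mul_one] at h
  refine le_trans (le_of_eq ?_) (h2.trans h)
  simp [Matrix.ofLp_toEuclideanCLM]

theorem entrySum_le_opNorm {d : ℕ} (M : GL (Fin d) ℝ) :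
    entrySum (M : Matrix (Fin d) (Fin d) ℝ) ≤ d * (d * opNorm M) :=
  entrySum_le_of_abs_le (abs_apply_le_opNorm M)

theorem opNorm_le_entrySum {d : ℕ} (M : GL (Fin d) ℝ) :
    opNorm M ≤ entrySum (M : Matrix (Fin d) (Fin d) ℝ) := by
  refine ContinuousLinearMap.opNorm_le_bound _ (entrySum_nonneg _) fun v => ?_
  have key : ∀ i, ‖(Matrix.toEuclideanCLM (n := Fin d) (𝕜 := ℝ)
      (M : Matrix (Fin d) (Fin d) ℝ) v) i‖ ≤
      (∑ j, |(M : Matrix (Fin d) (Fin d) ℝ) i j|) * ‖v‖ := by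
    intro i
    rw [Matrix.ofLp_toEuclideanCLM, Matrix.mulVec, dotProduct, Finset.sum_mul]
    refine (norm_sum_le _ _).trans (Finset.sum_le_sum fun j _ => ?_)
    rw [norm_mul]
    exact mul_le_mul_of_nonneg_left (PiLp.norm_apply_le v j) (abs_nonneg _)
  have h1 : ∀ w : EuclideanSpace ℝ (Fin d), ‖w‖ ≤ ∑ i, ‖w i‖ := by
    intro w
    rw [EuclideanSpace.norm_eq]
    exact Real.sqrt_le_iff.2 ⟨Finset.sum_nonneg fun _ _ => norm_nonneg _,
      Finset.sum_sq_le_sq_sum_of_nonneg fun _ _ => norm_nonneg _⟩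
  refine (h1 _).trans ?_
  rw [entrySum, Finset.sum_mul]
  exact Finset.sum_le_sum fun i _ => key i

theorem opNorm_mul_le {d : ℕ} (M N : GL (Fin d) ℝ) : opNorm (M * N) ≤ opNorm M * opNorm N := by
  unfold opNorm
  rw [Units.val_mul, map_mul]
  exact norm_mul_le _ _

/-- If `‖M‖ < 1`, then `det Mⁿ` tends to zero by the Leibniz formula. -/
theorem one_le_opNorm_of_abs_det {d : ℕ} [Nonempty (Fin d)] (M : GL (Fin d) ℝ)
    (h : |(M : Matrix (Fin d) (Fin d) ℝ).det| = 1) : 1 ≤ opNorm M := by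
  by_contra! hlt
  have hd : d ≠ 0 := by
    rintro rfl
    exact (Classical.arbitrary (Fin 0)).elim0
  have h0 : 0 ≤ opNorm M := norm_nonneg _
  have hpow : ∀ n : ℕ, opNorm (M ^ (n + 1)) ≤ opNorm M ^ (n + 1) := by
    intro n
    induction n with
    | zero => simp
    | succ n ih =>
      rw [pow_succ M, pow_succ (opNorm M)]
      exact (opNorm_mul_le _ _).trans (mul_le_mul_of_nonneg_right ih h0)
  have hdet : ∀ n : ℕ, 1 ≤ (d.factorial : ℝ) * (opNorm M ^ (n + 1)) ^ d := by
    intro n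
    have h1 := Matrix.det_le (A := ((M ^ (n + 1) : GL (Fin d) ℝ) : Matrix (Fin d) (Fin d) ℝ))
      (abv := AbsoluteValue.abs) (x := opNorm M ^ (n + 1))
      (fun i j => (abs_apply_le_opNorm _ i j).trans (hpow n))
    rw [Units.val_pow_eq_pow_val, Matrix.det_pow, map_pow] at h1
    simpa [h] using h1
  have hlim : Tendsto (fun n : ℕ => (d.factorial : ℝ) * (opNorm M ^ (n + 1)) ^ d) atTop
      (nhds ((d.factorial : ℝ) * 0 ^ d)) :=
    (((tendsto_pow_atTop_nhds_zero_of_lt_one h0 hlt).comp (tendsto_add_atTop_nat 1)).pow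
      d).const_mul _
  have := ge_of_tendsto' hlim hdet
  simp [hd] at this
  linarith

/-! ### Block triangular matrices -/

/-- The block diagonal part of a matrix, for the partition of the indices into the fibres
of `b`. -/
noncomputable def blockDiagPart {d k : ℕ} (b : Fin d → Fin k) (M : Matrix (Fin d) (Fin d) ℝ) :
    Matrix (Fin d) (Fin d) ℝ :=
  Matrix.of fun i j => if b i = b j then M i j else 0

theorem abs_blockDiagPart_le {d k : ℕ} (b : Fin d → Fin k) (M : Matrix (Fin d) (Fin d) ℝ)
    (i j : Fin d) : |blockDiagPart b M i j| ≤ |M i j| := by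
  simp only [blockDiagPart, Matrix.of_apply]
  split_ifs <;> simp

theorem blockDiagPart_mul {d k : ℕ} {b : Fin d → Fin k} {M N : Matrix (Fin d) (Fin d) ℝ}
    (hM : M.BlockTriangular b) (hN : N.BlockTriangular b) :
    blockDiagPart b (M * N) = blockDiagPart b M * blockDiagPart b N := by
  ext i j
  simp only [blockDiagPart, Matrix.of_apply, Matrix.mul_apply]
  split_ifs with h
  · refine Finset.sum_congr rfl fun a _ => ?_
    rcases lt_trichotomy (b i) (b a) with h1 | h1 | h1
    · rw [hN (h ▸ h1 : b j < b a)]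
      simp
    · simp [h1, h1 ▸ h]
    · rw [hM h1]
      simp
  · refine (Finset.sum_eq_zero fun a _ => ?_).symm
    by_cases h1 : b i = b a
    · rw [if_neg (fun h2 : b a = b j => h (h1.trans h2)), mul_zero]
    · rw [if_neg h1, zero_mul]

theorem toSquareBlock_mul_of_blockTriangular {d k : ℕ} {b : Fin d → Fin k}
    {M N : Matrix (Fin d) (Fin d) ℝ} (hM : M.BlockTriangular b) (hN : N.BlockTriangular b)
    (i : Fin k) :
    (M * N).toSquareBlock b i = M.toSquareBlock b i * N.toSquareBlock b i := by
  ext ⟨a, ha⟩ ⟨c, hc⟩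
  have key : ∑ e, M a e * N e c = ∑ e : {e // b e = i}, M a e * N e c := by
    rw [← Finset.sum_subtype (Finset.univ.filter fun e => b e = i) (by simp)
      (fun e => M a e * N e c), Finset.sum_filter]
    refine Finset.sum_congr rfl fun e _ => ?_
    split_ifs with h
    · rfl
    · rcases lt_or_gt_of_ne h with h1 | h1
      · rw [hM (show b e < b a by rwa [ha]), zero_mul]
      · rw [hN (show b c < b e by rwa [hc]), mul_zero]
  exact key

theorem det_blockDiagPart {d k : ℕ} {b : Fin d → Fin k} {M : Matrix (Fin d) (Fin d) ℝ}
    (hM : M.BlockTriangular b) : (blockDiagPart b M).det = M.det := by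
  have h : (blockDiagPart b M).BlockTriangular b := fun i j hij => by
    simp [blockDiagPart, hij.ne']
  rw [h.det_fintype, hM.det_fintype]
  refine Finset.prod_congr rfl fun i _ => congrArg _ ?_
  ext ⟨a, ha⟩ ⟨c, hc⟩
  simp [blockDiagPart, Matrix.toSquareBlock_def, ha, hc]

/-- The conjugate of `M` by the diagonal matrix with entries `t ^ b i`. Conjugation multiplies the
`(i, j)` entry by `t ^ (b j - b i)`, so it contracts the blocks above the diagonal as `t → 0`. -/
noncomputable def scaleConj {d k : ℕ} (b : Fin d → Fin k) (t : ℝ) (M : Matrix (Fin d) (Fin d) ℝ) :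
    Matrix (Fin d) (Fin d) ℝ :=
  Matrix.diagonal (fun i => (t ^ (b i : ℕ))⁻¹) * M * Matrix.diagonal (fun i => t ^ (b i : ℕ))

theorem scaleConj_apply {d k : ℕ} (b : Fin d → Fin k) (t : ℝ) (M : Matrix (Fin d) (Fin d) ℝ)
    (i j : Fin d) : scaleConj b t M i j = (t ^ (b i : ℕ))⁻¹ * M i j * t ^ (b j : ℕ) := by
  rw [scaleConj, Matrix.mul_diagonal, Matrix.diagonal_mul]

theorem scaleConj_mul {d k : ℕ} (b : Fin d → Fin k) {t : ℝ} (ht : t ≠ 0)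
    (M N : Matrix (Fin d) (Fin d) ℝ) :
    scaleConj b t (M * N) = scaleConj b t M * scaleConj b t N := by
  have h : Matrix.diagonal (fun i => t ^ (b i : ℕ)) *
      Matrix.diagonal (fun i => (t ^ (b i : ℕ))⁻¹) = (1 : Matrix (Fin d) (Fin d) ℝ) := by
    rw [Matrix.diagonal_mul_diagonal]
    simp [ht]
  simp only [scaleConj]
  rw [show Matrix.diagonal (fun i => (t ^ (b i : ℕ))⁻¹) * M *
      Matrix.diagonal (fun i => t ^ (b i : ℕ)) *
      (Matrix.diagonal (fun i => (t ^ (b i : ℕ))⁻¹) * N *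
      Matrix.diagonal (fun i => t ^ (b i : ℕ))) =
      Matrix.diagonal (fun i => (t ^ (b i : ℕ))⁻¹) * M *
      (Matrix.diagonal (fun i => t ^ (b i : ℕ)) *
      Matrix.diagonal (fun i => (t ^ (b i : ℕ))⁻¹)) * N *
      Matrix.diagonal (fun i => t ^ (b i : ℕ)) by simp only [Matrix.mul_assoc], h]
  simp only [Matrix.mul_assoc, Matrix.mul_one]

theorem scaleConj_inv_scaleConj {d k : ℕ} (b : Fin d → Fin k) {t : ℝ} (ht : t ≠ 0)
    (M : Matrix (Fin d) (Fin d) ℝ) : scaleConj b t⁻¹ (scaleConj b t M) = M := by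
  ext i j
  simp only [scaleConj_apply, inv_pow, inv_inv]
  field_simp

theorem det_scaleConj {d k : ℕ} (b : Fin d → Fin k) {t : ℝ} (ht : t ≠ 0)
    (M : Matrix (Fin d) (Fin d) ℝ) : (scaleConj b t M).det = M.det := by
  rw [scaleConj, Matrix.det_mul, Matrix.det_mul, Matrix.det_diagonal, Matrix.det_diagonal,
    Finset.prod_inv_distrib]
  have : ∏ i, t ^ (b i : ℕ) ≠ 0 := Finset.prod_ne_zero_iff.2 fun i _ => pow_ne_zero _ ht
  field_simp

theorem abs_scaleConj_le {d k : ℕ} {b : Fin d → Fin k} {t : ℝ} (h0 : 0 < t) (h1 : t ≤ 1)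
    {M : Matrix (Fin d) (Fin d) ℝ} (hM : M.BlockTriangular b) (i j : Fin d) :
    |scaleConj b t M i j| ≤ |M i j| := by
  rw [scaleConj_apply]
  rcases lt_or_ge (b j) (b i) with h | h
  · simp [hM h]
  · rw [show (t ^ (b i : ℕ))⁻¹ * M i j * t ^ (b j : ℕ) =
      M i j * ((t ^ (b i : ℕ))⁻¹ * t ^ (b j : ℕ)) by ring, abs_mul]
    refine mul_le_of_le_one_right (abs_nonneg _) ?_
    rw [abs_of_nonneg (by positivity), inv_mul_le_one₀ (by positivity)]
    exact pow_le_pow_of_le_one h0.le h1 h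

/-- Bound for the distortion of the norm caused by the conjugation `scaleConj b t`. -/
theorem exists_entrySum_scaleConj_le {d k : ℕ} (b : Fin d → Fin k) (t : ℝ) :
    ∃ c : ℝ, 1 ≤ c ∧ ∀ M : Matrix (Fin d) (Fin d) ℝ, entrySum (scaleConj b t M) ≤ c * entrySum M := by
  set D : Matrix (Fin d) (Fin d) ℝ := Matrix.diagonal (fun i => (t ^ (b i : ℕ))⁻¹)
  set E : Matrix (Fin d) (Fin d) ℝ := Matrix.diagonal (fun i => t ^ (b i : ℕ))
  refine ⟨max 1 (entrySum D * entrySum E), le_max_left _ _, fun M => ?_⟩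
  calc entrySum (D * M * E) ≤ entrySum D * entrySum M * entrySum E :=
        (entrySum_mul_le _ _).trans
          (mul_le_mul_of_nonneg_right (entrySum_mul_le _ _) (entrySum_nonneg _))
    _ = entrySum D * entrySum E * entrySum M := by ring
    _ ≤ _ := mul_le_mul_of_nonneg_right (le_max_right _ _) (entrySum_nonneg _)

theorem tendsto_scaleConj {d k : ℕ} {b : Fin d → Fin k} {M : Matrix (Fin d) (Fin d) ℝ}
    (hM : M.BlockTriangular b) {t : ℕ → ℝ} (hpos : ∀ n, 0 < t n)
    (ht : Tendsto t atTop (nhds 0)) :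
    Tendsto (fun n => scaleConj b (t n) M) atTop (nhds (blockDiagPart b M)) := by
  refine tendsto_pi_nhds.2 fun i => tendsto_pi_nhds.2 fun j => ?_
  simp only [scaleConj_apply, blockDiagPart, Matrix.of_apply]
  rcases lt_trichotomy (b i) (b j) with h | h | h
  · rw [if_neg h.ne]
    have e : ∀ n, (t n ^ (b i : ℕ))⁻¹ * M i j * t n ^ (b j : ℕ) =
        M i j * t n ^ ((b j : ℕ) - (b i : ℕ)) := by
      intro n
      have hn := (hpos n).ne'
      have h' : (b i : ℕ) ≤ b j := Fin.le_def.1 h.le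
      rw [← Nat.sub_add_cancel h', pow_add, Nat.add_sub_cancel]
      field_simp
    simp only [e]
    have h2 : (b j : ℕ) - (b i : ℕ) ≠ 0 := Nat.sub_ne_zero_of_lt h
    simpa [h2] using (ht.pow ((b j : ℕ) - (b i : ℕ))).const_mul (M i j)
  · rw [if_pos h]
    refine tendsto_const_nhds.congr fun n => ?_
    have hn := (hpos n).ne'
    rw [h]
    field_simp
  · simp [hM h]

/-! ### Growth along a stationary sequence -/

theorem integral_comp_of_measurePreserving {X : Type*} [MeasurableSpace X] {μ : Measure X}
    {T : X → X} (hT : MeasurePreserving T μ μ) {f : X → ℝ} (hf : AEStronglyMeasurable f μ) :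
    ∫ x, f (T x) ∂μ = ∫ x, f x ∂μ := by
  have hf' : AEStronglyMeasurable f (Measure.map T μ) := by rwa [hT.map_eq]
  rw [← integral_map hT.measurable.aemeasurable hf', hT.map_eq]

/-- The tails `min 1 (max 0 (φ - L))` of a finite-valued function have small integral. -/
theorem exists_integral_tail_lt {X : Type*} [MeasurableSpace X] {μ : Measure X}
    [IsProbabilityMeasure μ] {φ : X → ℝ} (hφ : AEMeasurable φ μ) {η : ℝ} (hη : 0 < η) :
    ∃ L₀ : ℕ, ∀ L : ℕ, L₀ ≤ L → ∫ x, min 1 (max 0 (φ x - L)) ∂μ < η := by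
  have h : Tendsto (fun L : ℕ => ∫ x, min 1 (max 0 (φ x - L)) ∂μ) atTop
      (nhds (∫ _, (0 : ℝ) ∂μ)) := by
    refine tendsto_integral_of_dominated_convergence (fun _ => (1 : ℝ)) (fun L => ?_)
      (integrable_const 1) (fun L => ae_of_all _ fun x => ?_) (ae_of_all _ fun x => ?_)
    · exact (aemeasurable_const.min (aemeasurable_const.max
        (hφ.sub aemeasurable_const))).aestronglyMeasurable
    · rw [Real.norm_eq_abs, abs_of_nonneg (by positivity)]
      exact min_le_left _ _
    · obtain ⟨n, hn⟩ := exists_nat_ge (φ x)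
      refine tendsto_const_nhds.congr' ((eventually_ge_atTop n).mono fun L hL => ?_)
      have : (n : ℝ) ≤ L := by exact_mod_cast hL
      have h0 : max 0 (φ x - L) = 0 := max_eq_left (by linarith)
      simp [h0]
  rw [integral_zero] at h
  exact eventually_atTop.1 (h.eventually (gt_mem_nhds hη))

/-- The part of an integrable function above a high level has small integral. -/
theorem exists_integral_excess_lt {X : Type*} [MeasurableSpace X] {μ : Measure X}
    {g : X → ℝ} (hg : Integrable g μ) {η : ℝ} (hη : 0 < η) :
    ∃ L : ℕ, ∫ x, max 0 (g x - L) ∂μ < η := by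
  have h : Tendsto (fun L : ℕ => ∫ x, max 0 (g x - L) ∂μ) atTop
      (nhds (∫ _, (0 : ℝ) ∂μ)) := by
    refine tendsto_integral_of_dominated_convergence (fun x => |g x|) (fun L => ?_)
      hg.abs (fun L => ae_of_all _ fun x => ?_) (ae_of_all _ fun x => ?_)
    · exact (aemeasurable_const.max
        (hg.aemeasurable.sub aemeasurable_const)).aestronglyMeasurable
    · rw [Real.norm_eq_abs, abs_of_nonneg (by positivity)]
      have := le_abs_self (g x)
      have : (0 : ℝ) ≤ L := by positivity
      exact max_le (abs_nonneg _) (by linarith)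
    · obtain ⟨n, hn⟩ := exists_nat_ge (g x)
      refine tendsto_const_nhds.congr' ((eventually_ge_atTop n).mono fun L hL => ?_)
      have : (n : ℝ) ≤ L := by exact_mod_cast hL
      exact (max_eq_left (by linarith)).symm
  rw [integral_zero] at h
  exact (h.eventually (gt_mem_nhds hη)).exists

/-- If `h N` is dominated both by a Birkhoff sum of an integrable function and by
`φ ∘ T^N + ψ` with `φ` and `ψ` finite, then `h N` has sublinear mean growth: the second bound is
`o(N)` in measure because `T` preserves `μ`, and the first makes `h N / N` uniformly
integrable. -/
theorem exists_integral_le_of_birkhoff_bound {X : Type*} [MeasurableSpace X] {μ : Measure X}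
    [IsProbabilityMeasure μ] {T : X → X} (hT : MeasurePreserving T μ μ) {g φ ψ : X → ℝ}
    (hg : Integrable g μ) (hφ : AEMeasurable φ μ) (hψ : AEMeasurable ψ μ) (c : ℝ)
    {h : ℕ → X → ℝ} (hh0 : ∀ N, ∀ᵐ x ∂μ, 0 ≤ h N x)
    (hh1 : ∀ N, ∀ᵐ x ∂μ, h N x ≤ c + ∑ k ∈ Finset.range N, g (T^[k] x))
    (hh2 : ∀ N, ∀ᵐ x ∂μ, h N x ≤ φ (T^[N] x) + ψ x) {ε : ℝ} (hε : 0 < ε) :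
    ∃ N : ℕ, 1 ≤ N ∧ ∫ x, h N x ∂μ ≤ ε * N := by
  -- `g` is truncated at height `M`, and `φ`, `ψ` exceed `L` with small probability
  -- relative to `1/M`
  obtain ⟨M, hM⟩ := exists_integral_excess_lt hg (show 0 < ε / 4 by positivity)
  have hη : 0 < ε / (8 * (M + 1)) := by positivity
  obtain ⟨L₁, hL₁⟩ := exists_integral_tail_lt hφ hη
  obtain ⟨L₂, hL₂⟩ := exists_integral_tail_lt hψ hη
  set L := max L₁ L₂
  have hφL := hL₁ L (le_max_left _ _)
  have hψL := hL₂ L (le_max_right _ _)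
  obtain ⟨N, hN⟩ := exists_nat_ge ((2 * (L + 1) + |c|) / (ε / 4))
  have hcN : 2 * (L + 1) + |c| ≤ N * (ε / 4) := (div_le_iff₀ (by positivity)).1 hN
  have hN1 : 1 ≤ N := by
    rcases Nat.eq_zero_or_pos N with h0 | h0
    · rw [h0] at hcN
      have := abs_nonneg c
      have : (0 : ℝ) ≤ L := by positivity
      norm_num at hcN
      linarith
    · exact h0
  refine ⟨N, hN1, ?_⟩
  set G : X → ℝ := fun x => max 0 (g x - M)
  set u : X → ℝ := fun x => min 1 (max 0 (φ x - L))
  set v : X → ℝ := fun x => min 1 (max 0 (ψ x - L))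
  have hG : Integrable G μ := by
    refine hg.abs.mono' (aemeasurable_const.max
        (hg.aemeasurable.sub aemeasurable_const)).aestronglyMeasurable (ae_of_all _ fun x => ?_)
    rw [Real.norm_eq_abs, abs_of_nonneg (le_max_left _ _)]
    have := le_abs_self (g x)
    have : (0 : ℝ) ≤ M := by positivity
    exact max_le (abs_nonneg _) (by linarith)
  have htail : ∀ θ : X → ℝ, AEMeasurable θ μ →
      Integrable (fun x => min 1 (max 0 (θ x - L))) μ := by
    intro θ hθ
    refine (integrable_const (1 : ℝ)).mono' (aemeasurable_const.min (aemeasurable_const.max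
        (hθ.sub aemeasurable_const))).aestronglyMeasurable (ae_of_all _ fun x => ?_)
    rw [Real.norm_eq_abs, abs_of_nonneg (by positivity)]
    exact min_le_left _ _
  have hu : Integrable u μ := htail φ hφ
  have hv : Integrable v μ := htail ψ hψ
  have hiter : ∀ k : ℕ, MeasurePreserving (T^[k]) μ μ := fun k => hT.iterate k
  have hGk : ∀ k : ℕ, Integrable (fun x => G (T^[k] x)) μ :=
    fun k => (hiter k).integrable_comp_of_integrable hG
  have huN : Integrable (fun x => u (T^[N] x)) μ := (hiter N).integrable_comp_of_integrable hu
  have hS : Integrable (fun x => ∑ k ∈ Finset.range N, G (T^[k] x)) μ :=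
    integrable_finsetSum _ fun k _ => hGk k
  have hpt : ∀ᵐ x ∂μ, h N x ≤ (2 * (L + 1) + |c|) + ∑ k ∈ Finset.range N, G (T^[k] x) +
      (N * M) * (u (T^[N] x) + v x) := by
    filter_upwards [hh1 N, hh2 N] with x hx1 hx2
    have hG0 : 0 ≤ ∑ k ∈ Finset.range N, G (T^[k] x) :=
      Finset.sum_nonneg fun k _ => le_max_left _ _
    have hu0 : 0 ≤ u (T^[N] x) := by positivity
    have hv0 : 0 ≤ v x := by positivity
    have hNM : (0 : ℝ) ≤ N * M := by positivity
    have hc := abs_nonneg c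
    -- the bound by `φ` and `ψ` is used where both are small, the Birkhoff bound elsewhere
    by_cases hE : φ (T^[N] x) ≤ L + 1 ∧ ψ x ≤ L + 1
    · have : 0 ≤ (N * M : ℝ) * (u (T^[N] x) + v x) := by positivity
      linarith [hE.1, hE.2]
    · have huv : 1 ≤ u (T^[N] x) + v x := by
        have aux : ∀ s : ℝ, L + 1 < s → min 1 (max 0 (s - L)) = 1 := fun s hs =>
          min_eq_left (le_max_of_le_right (by linarith))
        rcases not_and_or.1 hE with h1 | h1
        · have : u (T^[N] x) = 1 := aux _ (not_le.1 h1)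
          linarith
        · have : v x = 1 := aux _ (not_le.1 h1)
          linarith
      have hsum : ∑ k ∈ Finset.range N, g (T^[k] x) ≤
          ∑ k ∈ Finset.range N, G (T^[k] x) + N * M := by
        calc ∑ k ∈ Finset.range N, g (T^[k] x) ≤ ∑ k ∈ Finset.range N, (G (T^[k] x) + M) :=
              Finset.sum_le_sum fun k _ => by
                have : g (T^[k] x) - M ≤ G (T^[k] x) := le_max_right _ _
                linarith
          _ = _ := by simp [Finset.sum_add_distrib]
      have := mul_le_mul_of_nonneg_left huv hNM
      have : (0 : ℝ) ≤ L := by positivity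
      linarith [le_abs_self c]
  have hint : Integrable (fun x => (2 * (L + 1) + |c|) + ∑ k ∈ Finset.range N, G (T^[k] x) +
      (N * M) * (u (T^[N] x) + v x)) μ :=
    ((integrable_const _).add hS).add ((huN.add hv).const_mul _)
  have hle := integral_mono_of_nonneg (hh0 N) hint hpt
  have huvN : Integrable (fun x => u (T^[N] x) + v x) μ := huN.add hv
  have hcS : Integrable (fun x => (2 * (L + 1) + |c|) + ∑ k ∈ Finset.range N, G (T^[k] x)) μ :=
    (integrable_const _).add hS
  have hval : ∫ x, ((2 * (L + 1) + |c|) + ∑ k ∈ Finset.range N, G (T^[k] x) +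
      (N * M) * (u (T^[N] x) + v x)) ∂μ =
      (2 * (L + 1) + |c|) + N * ∫ x, G x ∂μ + (N * M) * (∫ x, u x ∂μ + ∫ x, v x ∂μ) := by
    rw [integral_add hcS (huvN.const_mul _),
      integral_add (integrable_const _) hS, integral_const_mul, integral_add huN hv,
      integral_finsetSum _ fun k _ => hGk k,
      integral_comp_of_measurePreserving (hiter N) hu.aestronglyMeasurable]
    simp only [integral_comp_of_measurePreserving (hiter _) hG.aestronglyMeasurable]
    simp
  rw [hval] at hle
  have hNpos : (0 : ℝ) < N := by exact_mod_cast hN1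
  have e1 : N * ∫ x, G x ∂μ ≤ N * (ε / 4) := mul_le_mul_of_nonneg_left hM.le hNpos.le
  have e2 : (N * M) * (∫ x, u x ∂μ + ∫ x, v x ∂μ) ≤ N * (ε / 4) := by
    rw [mul_assoc]
    refine mul_le_mul_of_nonneg_left ?_ hNpos.le
    have h1 : ∫ x, u x ∂μ + ∫ x, v x ∂μ ≤ ε / (4 * (M + 1)) := by
      have : ε / (4 * ((M : ℝ) + 1)) = ε / (8 * (M + 1)) + ε / (8 * (M + 1)) := by
        field_simp
        norm_num
      linarith
    calc (M : ℝ) * (∫ x, u x ∂μ + ∫ x, v x ∂μ) ≤ M * (ε / (4 * (M + 1))) :=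
          mul_le_mul_of_nonneg_left h1 (by positivity)
      _ = ε / 4 * (M / (M + 1)) := by field_simp
      _ ≤ ε / 4 := mul_le_of_le_one_right (by positivity)
          ((div_le_one (by positivity)).2 (by linarith))
  have : 0 < N * ε := by positivity
  linarith

/-! ### Measurable triangularisation -/

/-- The orthogonal factor of the QR decomposition: its columns are the normalised Gram–Schmidt
vectors of the columns of `M`. -/
noncomputable def orthFactor {d : ℕ} (M : Matrix (Fin d) (Fin d) ℝ) : Matrix (Fin d) (Fin d) ℝ :=
  Matrix.of fun i j =>
    InnerProductSpace.gramSchmidtNormed ℝ (fun j => WithLp.toLp 2 (fun i => M i j)) j i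

theorem linearIndependent_columns {d : ℕ} {M : Matrix (Fin d) (Fin d) ℝ} (hM : IsUnit M.det) :
    LinearIndependent ℝ
      (fun j => (WithLp.toLp 2 (fun i => M i j) : EuclideanSpace ℝ (Fin d))) := by
  have h := Matrix.linearIndependent_cols_of_isUnit ((Matrix.isUnit_iff_isUnit_det M).2 hM)
  exact h.map' (WithLp.linearEquiv 2 ℝ (Fin d → ℝ)).symm.toLinearMap (LinearEquiv.ker _)

theorem orthFactor_transpose_mul_self {d : ℕ} {M : Matrix (Fin d) (Fin d) ℝ}
    (hM : IsUnit M.det) : (orthFactor M)ᵀ * orthFactor M = 1 := by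
  have h := InnerProductSpace.gramSchmidtNormed_orthonormal (linearIndependent_columns hM)
  rw [orthonormal_iff_ite] at h
  ext i j
  rw [Matrix.mul_apply, Matrix.one_apply, ← h i j, PiLp.inner_apply]
  exact Finset.sum_congr rfl fun k _ => by
    simp [orthFactor, mul_comm]

theorem orthFactor_transpose_mul_apply_eq_zero {d : ℕ} (M : Matrix (Fin d) (Fin d) ℝ)
    {i j : Fin d} (hij : j < i) : ((orthFactor M)ᵀ * M) i j = 0 := by
  have h := InnerProductSpace.gramSchmidt_inv_triangular ℝ
    (fun j => (WithLp.toLp 2 (fun i => M i j) : EuclideanSpace ℝ (Fin d))) hij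
  have h' : inner ℝ (InnerProductSpace.gramSchmidtNormed ℝ
      (fun j => (WithLp.toLp 2 (fun i => M i j) : EuclideanSpace ℝ (Fin d))) i)
      (WithLp.toLp 2 (fun i => M i j) : EuclideanSpace ℝ (Fin d)) = 0 := by
    rw [InnerProductSpace.gramSchmidtNormed, inner_smul_left, h, mul_zero]
  rw [← h', PiLp.inner_apply, Matrix.mul_apply]
  exact Finset.sum_congr rfl fun k _ => by
    simp [orthFactor, mul_comm]

theorem abs_orthFactor_le_one {d : ℕ} {M : Matrix (Fin d) (Fin d) ℝ} (hM : IsUnit M.det)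
    (i j : Fin d) : |orthFactor M i j| ≤ 1 := by
  have h := InnerProductSpace.gramSchmidtNormed_unit_length j (linearIndependent_columns hM)
  exact (PiLp.norm_apply_le _ i).trans h.le

theorem aemeasurable_orthFactor {X : Type*} [MeasurableSpace X] {μ : Measure X} {d : ℕ}
    {M : X → Matrix (Fin d) (Fin d) ℝ} (hM : ∀ i j, AEMeasurable (fun x => M x i j) μ)
    (i j : Fin d) : AEMeasurable (fun x => orthFactor (M x) i j) μ := by
  set f : X → Fin d → EuclideanSpace ℝ (Fin d) := fun x j => WithLp.toLp 2 (fun i => M x i j)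
  have hf : ∀ j, AEMeasurable (fun x => f x j) μ := fun j =>
    (WithLp.measurable_toLp 2 (Fin d → ℝ)).comp_aemeasurable
      (aemeasurable_pi_lambda _ fun i => hM i j)
  have hgs : ∀ j, AEMeasurable (fun x => InnerProductSpace.gramSchmidt ℝ (f x) j) μ := by
    intro j
    induction j using WellFoundedLT.induction with
    | ind j ih =>
      simp only [InnerProductSpace.gramSchmidt_def ℝ _ j, Submodule.starProjection_singleton]
      refine (hf j).sub (Finset.aemeasurable_fun_sum _ fun k hk => ?_)
      have hk' := ih k (Finset.mem_Iio.1 hk)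
      exact ((hk'.inner (hf j)).div (hk'.norm.pow_const 2)).smul hk'
  have hn : AEMeasurable (fun x => InnerProductSpace.gramSchmidtNormed ℝ (f x) j) μ :=
    (hgs j).norm.inv.smul (hgs j)
  exact (measurable_pi_apply i).comp_aemeasurable
    ((WithLp.measurable_ofLp 2 (Fin d → ℝ)).comp_aemeasurable hn)

/-! ### Zimmer blocks -/

/-- The determinant maps a compact subgroup of `GL(n, ℝ)` into `{1, -1}`, since the powers of
`|det N|` stay bounded. -/
theorem abs_det_le_one_of_mem_compact_subgroup {n : Type*} [Fintype n] [DecidableEq n]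
    {K : Subgroup (GL n ℝ)} (hK : IsCompact (K : Set (GL n ℝ))) {N : GL n ℝ} (hN : N ∈ K) :
    |(N : Matrix n n ℝ).det| ≤ 1 := by
  obtain ⟨C, hC⟩ := hK.exists_bound_of_continuousOn
    (f := fun N : GL n ℝ => (N : Matrix n n ℝ).det) Units.continuous_val.matrix_det.continuousOn
  by_contra! hlt
  obtain ⟨m, hm⟩ := pow_unbounded_of_one_lt C hlt
  have := hC (N ^ m) (K.pow_mem hN m)
  simp only [Units.val_pow_eq_pow_val, Matrix.det_pow, norm_pow, Real.norm_eq_abs] at this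
  linarith

theorem abs_det_eq_one_of_mem_compact_subgroup {n : Type*} [Fintype n] [DecidableEq n]
    {K : Subgroup (GL n ℝ)} (hK : IsCompact (K : Set (GL n ℝ))) {N : GL n ℝ} (hN : N ∈ K) :
    |(N : Matrix n n ℝ).det| = 1 := by
  have h1 := abs_det_le_one_of_mem_compact_subgroup hK hN
  have h2 := abs_det_le_one_of_mem_compact_subgroup hK (K.inv_mem hN)
  have h3 : |(N : Matrix n n ℝ).det| * |((N⁻¹ : GL n ℝ) : Matrix n n ℝ).det| = 1 := by
    rw [← abs_mul, ← Matrix.det_mul, ← Units.val_mul]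
    simp
  nlinarith [abs_nonneg (N : Matrix n n ℝ).det, abs_nonneg ((N⁻¹ : GL n ℝ) : Matrix n n ℝ).det]

/-- A Zimmer block of exponent `0` is a group of block triangular matrices of determinant `±1`
with bounded block diagonal part. -/
theorem IsZimmerBlock.exists_subgroup {d : ℕ} {U : Set (GL (Fin d) ℝ)} (hU : IsZimmerBlock 0 U) :
    ∃ (H : Subgroup (GL (Fin d) ℝ)) (k : ℕ) (b : Fin d → Fin k) (C : ℝ),
      (∀ M, M ∈ H ↔ M ∈ U) ∧ Monotone b ∧ 1 ≤ C ∧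
      ∀ M ∈ H, (M : Matrix (Fin d) (Fin d) ℝ).BlockTriangular b ∧
        |(M : Matrix (Fin d) (Fin d) ℝ).det| = 1 ∧
        entrySum (blockDiagPart b (M : Matrix (Fin d) (Fin d) ℝ)) ≤ C := by
  obtain ⟨k, b, K, hb, -, hK, rfl⟩ := hU
  simp only [Real.exp_zero, one_smul]
  have htri : ∀ M : GL (Fin d) ℝ, (M : Matrix (Fin d) (Fin d) ℝ).BlockTriangular b →
      ((M⁻¹ : GL (Fin d) ℝ) : Matrix (Fin d) (Fin d) ℝ).BlockTriangular b := by
    intro M hM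
    have : Invertible (M : Matrix (Fin d) (Fin d) ℝ) := M.invertible
    rw [Matrix.coe_units_inv]
    exact Matrix.blockTriangular_inv_of_blockTriangular hM
  have hone : ∀ i, (1 : Matrix (Fin d) (Fin d) ℝ).toSquareBlock b i = 1 := by
    intro i
    ext ⟨a, ha⟩ ⟨c, hc⟩
    simp [Matrix.toSquareBlock_def, Matrix.one_apply]
  let H : Subgroup (GL (Fin d) ℝ) :=
    { carrier := {M | (M : Matrix (Fin d) (Fin d) ℝ).BlockTriangular b ∧
        ∀ i, ∃ N ∈ K i, (M : Matrix (Fin d) (Fin d) ℝ).toSquareBlock b i =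
          (N : Matrix {a : Fin d // b a = i} {a : Fin d // b a = i} ℝ)}
      mul_mem' := by
        rintro M M' ⟨hM, hM'⟩ ⟨hN, hN'⟩
        refine ⟨by rw [Units.val_mul]; exact hM.mul hN, fun i => ?_⟩
        obtain ⟨P, hP, eP⟩ := hM' i
        obtain ⟨R, hR, eR⟩ := hN' i
        exact ⟨P * R, (K i).mul_mem hP hR, by
          rw [Units.val_mul, toSquareBlock_mul_of_blockTriangular hM hN, eP, eR, Units.val_mul]⟩
      one_mem' := ⟨Matrix.blockTriangular_one, fun i => ⟨1, (K i).one_mem, by simpa using hone i⟩⟩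
      inv_mem' := by
        rintro M ⟨hM, hM'⟩
        refine ⟨htri M hM, fun i => ?_⟩
        obtain ⟨P, hP, eP⟩ := hM' i
        refine ⟨P⁻¹, (K i).inv_mem hP, ?_⟩
        have h1 : (M : Matrix (Fin d) (Fin d) ℝ).toSquareBlock b i *
            ((M⁻¹ : GL (Fin d) ℝ) : Matrix (Fin d) (Fin d) ℝ).toSquareBlock b i = 1 := by
          rw [← toSquareBlock_mul_of_blockTriangular hM (htri M hM), ← Units.val_mul,
            mul_inv_cancel, Units.val_one, hone]
        rw [eP] at h1
        rw [Matrix.coe_units_inv P]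
        exact (Matrix.inv_eq_right_inv h1).symm }
  have hbound : ∀ i, ∀ a c, ∃ C : ℝ, ∀ N ∈ K i,
      |(N : Matrix {a : Fin d // b a = i} {a : Fin d // b a = i} ℝ) a c| ≤ C := by
    intro i a c
    exact (hK i).exists_bound_of_continuousOn
      (f := fun N : GL {a : Fin d // b a = i} ℝ =>
        (N : Matrix {a : Fin d // b a = i} {a : Fin d // b a = i} ℝ) a c)
      (Units.continuous_val.matrix_elem a c).continuousOn
  choose C hC using hbound
  refine ⟨H, k, b, max 1 (∑ a, ∑ c, if h : b c = b a then C (b a) ⟨a, rfl⟩ ⟨c, h⟩ else 0),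
    fun M => Iff.rfl, hb, le_max_left _ _, ?_⟩
  rintro M ⟨hM, hM'⟩
  refine ⟨hM, ?_, le_max_of_le_right ?_⟩
  · rw [hM.det_fintype, Finset.abs_prod]
    refine Finset.prod_eq_one fun i _ => ?_
    obtain ⟨P, hP, eP⟩ := hM' i
    rw [eP]
    exact abs_det_eq_one_of_mem_compact_subgroup (hK i) hP
  · refine Finset.sum_le_sum fun a _ => Finset.sum_le_sum fun c _ => ?_
    simp only [blockDiagPart, Matrix.of_apply]
    by_cases h : b c = b a
    · obtain ⟨P, hP, eP⟩ := hM' (b a)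
      have e := congrFun (congrFun eP ⟨a, rfl⟩) ⟨c, h⟩
      rw [Matrix.toSquareBlock_def, Matrix.of_apply] at e
      rw [dif_pos h, if_pos h.symm, e]
      exact hC _ _ _ P hP
    · rw [dif_neg h, if_neg (fun h' => h h'.symm), abs_zero]

/-! ### Cocycles -/

theorem forwardProduct_add {X G : Type*} [Group G] (T : Equiv.Perm X) (A : X → G) (n m : ℕ)
    (x : X) : forwardProduct T A (n + m) x =
      forwardProduct T A n ((T ^ m) x) * forwardProduct T A m x := by
  induction n with
  | zero => simp [forwardProduct]
  | succ n ih =>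
    rw [Nat.add_right_comm]
    simp only [forwardProduct]
    rw [ih, pow_add, Equiv.Perm.mul_apply, mul_assoc]

theorem conj_forwardProduct_mem {X G : Type*} [Group G] {T : Equiv.Perm X} {A α : X → G}
    {H : Subgroup G} {x : X}
    (h : ∀ k : ℕ, α (T ((T ^ k) x)) * A ((T ^ k) x) * (α ((T ^ k) x))⁻¹ ∈ H) (n : ℕ) :
    α ((T ^ n) x) * forwardProduct T A n x * (α x)⁻¹ ∈ H := by
  induction n with
  | zero => simp [forwardProduct]
  | succ n ih =>
    have := H.mul_mem (h n) ih
    convert this using 1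
    simp only [forwardProduct, pow_succ', Equiv.Perm.mul_apply]
    group

/-- The backward products of a cocycle are the forward products of its inverse, which is a cocycle
over `T⁻¹`. -/
theorem backwardProduct_eq_forwardProduct {X G : Type*} [Group G] (T : Equiv.Perm X) (A : X → G)
    (n : ℕ) (x : X) :
    backwardProduct T A n x = forwardProduct T⁻¹ (fun y => (A (T⁻¹ y))⁻¹) n x := by
  induction n with
  | zero => rfl
  | succ n ih =>
    simp only [backwardProduct, forwardProduct, ih]
    congr 3
    rw [← Equiv.Perm.mul_apply, ← pow_succ', _root_.zpow_neg, inv_pow]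
    norm_cast

theorem cocycle_neg_natCast {X G : Type*} [Group G] (T : Equiv.Perm X) (A : X → G)
    (n : ℕ) (x : X) :
    cocycle T A (-(n : ℤ)) x = forwardProduct T⁻¹ (fun y => (A (T⁻¹ y))⁻¹) n x := by
  rw [← backwardProduct_eq_forwardProduct]
  cases n <;> rfl

theorem aemeasurable_entrySum {X : Type*} [MeasurableSpace X] {μ : Measure X} {d : ℕ}
    {M : X → Matrix (Fin d) (Fin d) ℝ} (hM : ∀ i j, AEMeasurable (fun x => M x i j) μ) :
    AEMeasurable (fun x => entrySum (M x)) μ :=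
  Finset.aemeasurable_fun_sum _ fun i _ => Finset.aemeasurable_fun_sum _ fun j _ => (hM i j).abs

theorem aemeasurable_mul_apply {X : Type*} [MeasurableSpace X] {μ : Measure X} {d : ℕ}
    {M N : X → Matrix (Fin d) (Fin d) ℝ} (hM : ∀ i j, AEMeasurable (fun x => M x i j) μ)
    (hN : ∀ i j, AEMeasurable (fun x => N x i j) μ) (i j : Fin d) :
    AEMeasurable (fun x => (M x * N x) i j) μ := by
  simp only [Matrix.mul_apply]
  exact Finset.aemeasurable_fun_sum _ fun k _ => (hM i k).mul (hN k j)

theorem aemeasurable_inv_apply {X : Type*} [MeasurableSpace X] {μ : Measure X} {d : ℕ}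
    {M : X → Matrix (Fin d) (Fin d) ℝ} (hM : ∀ i j, AEMeasurable (fun x => M x i j) μ)
    (i j : Fin d) : AEMeasurable (fun x => (M x)⁻¹ i j) μ := by
  let f : X → Fin d → Fin d → ℝ := fun x i j => M x i j
  have hf : AEMeasurable f μ :=
    aemeasurable_pi_lambda _ fun i => aemeasurable_pi_lambda _ fun j => hM i j
  have c1 : Continuous fun P : Fin d → Fin d → ℝ => (Matrix.of P).det :=
    Continuous.matrix_det continuous_id
  have c2 : Continuous fun P : Fin d → Fin d → ℝ => (Matrix.of P).adjugate i j :=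
    Continuous.matrix_elem (Continuous.matrix_adjugate continuous_id) i j
  simp only [Matrix.inv_def, Matrix.smul_apply, smul_eq_mul, Ring.inverse_eq_inv']
  exact (c1.measurable.comp_aemeasurable hf).inv.mul (c2.measurable.comp_aemeasurable hf)

theorem ae_forall_iterate {X : Type*} [MeasurableSpace X] {μ : Measure X} {T : X → X}
    (hT : MeasurePreserving T μ μ) {P : X → Prop} (h : ∀ᵐ x ∂μ, P x) :
    ∀ᵐ x ∂μ, ∀ n : ℕ, P (T^[n] x) :=
  ae_all_iff.2 fun n => (hT.iterate n).quasiMeasurePreserving.ae h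

theorem one_le_entrySum_of_abs_det {d : ℕ} [Nonempty (Fin d)] {M : Matrix (Fin d) (Fin d) ℝ}
    (h : |M.det| = 1) : 1 ≤ entrySum M := by
  have hne : M.det ≠ 0 := fun h0 => by simp [h0] at h
  exact (one_le_opNorm_of_abs_det (Matrix.GeneralLinearGroup.mkOfDetNeZero M hne) h).trans
    (opNorm_le_entrySum _)

/-- The growth of a block triangular cocycle is at most that of the block diagonal part of any
fixed iterate. By `scaleConj`, the cocycle is conjugate to one whose `N`-th iterate is as close to
block diagonal as desired, while a constant conjugation changes the growth only by a
bounded amount. -/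
theorem exists_integral_log_entrySum_le_blockDiagPart {X : Type*} [MeasurableSpace X]
    {μ : Measure X} [IsProbabilityMeasure μ] {T : X → X} (hT : MeasurePreserving T μ μ) {d k : ℕ}
    [Nonempty (Fin d)] {b : Fin d → Fin k} {B : ℕ → X → Matrix (Fin d) (Fin d) ℝ}
    (hmeas : ∀ n i j, AEMeasurable (fun x => B n x i j) μ)
    (hmul : ∀ᵐ x ∂μ, ∀ n m, B (n + m) x = B n (T^[m] x) * B m x)
    (htri : ∀ᵐ x ∂μ, ∀ n, (B n x).BlockTriangular b)
    (hdet : ∀ᵐ x ∂μ, ∀ n, |(B n x).det| = 1)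
    (hint : ∀ n, Integrable (fun x => Real.log (entrySum (B n x))) μ)
    (N : ℕ) {ε : ℝ} (hε : 0 < ε) :
    ∃ c : ℝ, ∀ m : ℕ, ∫ x, Real.log (entrySum (B ((m + 1) * N) x)) ∂μ ≤
      c + (m + 1) * (∫ x, Real.log (entrySum (blockDiagPart b (B N x))) ∂μ + ε) := by
  set t : ℕ → ℝ := fun n => 1 / ((n : ℝ) + 1)
  have tpos : ∀ n, 0 < t n := fun n => by positivity
  have tle : ∀ n, t n ≤ 1 := fun n => by
    rw [div_le_one (by positivity)]
    linarith [(Nat.cast_nonneg n : (0 : ℝ) ≤ n)]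
  have tlim : Tendsto t atTop (nhds 0) := tendsto_one_div_add_atTop_nhds_zero_nat
  have hqmeas : ∀ n, AEStronglyMeasurable
      (fun x => Real.log (entrySum (scaleConj b (t n) (B N x)))) μ := by
    intro n
    refine (Real.measurable_log.comp_aemeasurable
      (aemeasurable_entrySum fun i j => ?_)).aestronglyMeasurable
    simp only [scaleConj_apply]
    exact ((hmeas N i j).const_mul _).mul_const _
  have hqbound : ∀ n, ∀ᵐ x ∂μ, ‖Real.log (entrySum (scaleConj b (t n) (B N x)))‖ ≤
      Real.log (entrySum (B N x)) := by
    intro n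
    filter_upwards [htri, hdet] with x hx hx'
    have h1 : 1 ≤ entrySum (scaleConj b (t n) (B N x)) :=
      one_le_entrySum_of_abs_det (by rw [det_scaleConj b (tpos n).ne', hx' N])
    rw [Real.norm_of_nonneg (Real.log_nonneg h1)]
    exact Real.log_le_log (by linarith)
      (entrySum_mono (abs_scaleConj_le (tpos n) (tle n) (hx N)))
  have hlim : Tendsto (fun n => ∫ x, Real.log (entrySum (scaleConj b (t n) (B N x))) ∂μ) atTop
      (nhds (∫ x, Real.log (entrySum (blockDiagPart b (B N x))) ∂μ)) := by
    refine tendsto_integral_of_dominated_convergence _ hqmeas (hint N) hqbound ?_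
    filter_upwards [htri, hdet] with x hx hx'
    have h1 : 1 ≤ entrySum (blockDiagPart b (B N x)) :=
      one_le_entrySum_of_abs_det (by rw [det_blockDiagPart (hx N), hx' N])
    exact ((continuous_entrySum.tendsto _).comp (tendsto_scaleConj (hx N) tpos tlim)).log
      (by positivity)
  obtain ⟨n, hn⟩ := (hlim.eventually (gt_mem_nhds (lt_add_of_pos_right _ hε))).exists
  set q : X → ℝ := fun x => Real.log (entrySum (scaleConj b (t n) (B N x)))
  have hq : Integrable q μ := (hint N).mono' (hqmeas n) (hqbound n)
  obtain ⟨κ, hκ, hκ'⟩ := exists_entrySum_scaleConj_le b (t n)⁻¹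
  refine ⟨Real.log κ, fun m => ?_⟩
  have hqj : ∀ j : ℕ, Integrable (fun x => q (T^[j * N] x)) μ :=
    fun j => (hT.iterate _).integrable_comp_of_integrable hq
  have hsum : Integrable (fun x => ∑ j ∈ Finset.range (m + 1), q (T^[j * N] x)) μ :=
    integrable_finsetSum _ fun j _ => hqj j
  have hpt : ∀ᵐ x ∂μ, Real.log (entrySum (B ((m + 1) * N) x)) ≤
      Real.log κ + ∑ j ∈ Finset.range (m + 1), q (T^[j * N] x) := by
    filter_upwards [hmul, hdet, ae_forall_iterate hT hdet] with x hx hx' hxT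
    have hge : ∀ m, 1 ≤ entrySum (scaleConj b (t n) (B m x)) := fun m =>
      one_le_entrySum_of_abs_det (by rw [det_scaleConj b (tpos n).ne', hx'])
    have hgeT : ∀ m l, 1 ≤ entrySum (scaleConj b (t n) (B l (T^[m] x))) := fun m l =>
      one_le_entrySum_of_abs_det (by rw [det_scaleConj b (tpos n).ne', hxT])
    have hstep : ∀ m, Real.log (entrySum (scaleConj b (t n) (B ((m + 1) * N) x))) ≤
        ∑ j ∈ Finset.range (m + 1), q (T^[j * N] x) := by
      intro m
      induction m with
      | zero => simp [q]
      | succ m ih =>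
        rw [Finset.sum_range_succ, add_mul (m + 1) 1 N, one_mul, add_comm ((m + 1) * N) N, hx,
          scaleConj_mul b (tpos n).ne', add_comm (∑ j ∈ Finset.range (m + 1), q (T^[j * N] x))]
        have h1 := hgeT ((m + 1) * N) N
        have h2 := hge ((m + 1) * N)
        have h3 : 1 ≤ entrySum (scaleConj b (t n) (B N (T^[(m + 1) * N] x)) *
            scaleConj b (t n) (B ((m + 1) * N) x)) := by
          rw [← scaleConj_mul b (tpos n).ne', ← hx]
          exact hge _
        refine (Real.log_le_log (by linarith) (entrySum_mul_le _ _)).trans ?_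
        rw [Real.log_mul (by linarith) (by linarith)]
        exact add_le_add le_rfl ih
    have h1 := hκ' (scaleConj b (t n) (B ((m + 1) * N) x))
    rw [scaleConj_inv_scaleConj b (tpos n).ne'] at h1
    have h2 := one_le_entrySum_of_abs_det (hx' ((m + 1) * N))
    have h3 := hge ((m + 1) * N)
    refine (Real.log_le_log (by linarith) h1).trans ?_
    rw [Real.log_mul (by linarith) (by linarith)]
    exact add_le_add le_rfl (hstep m)
  calc ∫ x, Real.log (entrySum (B ((m + 1) * N) x)) ∂μ
      ≤ ∫ x, (Real.log κ + ∑ j ∈ Finset.range (m + 1), q (T^[j * N] x)) ∂μ :=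
        integral_mono_ae (hint _) ((integrable_const _).add hsum) hpt
    _ = Real.log κ + (m + 1) * ∫ x, q x ∂μ := by
        rw [integral_add (integrable_const _) hsum, integral_finsetSum _ fun j _ => hqj j]
        simp only [integral_comp_of_measurePreserving (hT.iterate _) hq.aestronglyMeasurable]
        simp
    _ ≤ _ := by
        have : (0 : ℝ) ≤ m + 1 := by positivity
        exact add_le_add le_rfl (mul_le_mul_of_nonneg_left hn.le this)

/-! ### Cocycles conjugate into a Zimmer block -/

theorem abs_det_orthFactor {d : ℕ} {M : Matrix (Fin d) (Fin d) ℝ} (hM : IsUnit M.det) :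
    |(orthFactor M).det| = 1 := by
  have h := congrArg Matrix.det (orthFactor_transpose_mul_self hM)
  rw [Matrix.det_mul, Matrix.det_transpose, Matrix.det_one, ← abs_mul_abs_self] at h
  nlinarith [abs_nonneg (orthFactor M).det]

theorem aemeasurable_forwardProduct_apply {X : Type*} [MeasurableSpace X] {μ : Measure X} {d : ℕ}
    {T : Equiv.Perm X} (hT : MeasurePreserving T μ μ) {A : X → GL (Fin d) ℝ}
    (hA : ∀ i j, AEMeasurable (fun x => (A x : Matrix (Fin d) (Fin d) ℝ) i j) μ) (n : ℕ)
    (i j : Fin d) :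
    AEMeasurable (fun x => ((forwardProduct T A n x : GL (Fin d) ℝ) : Matrix (Fin d) (Fin d) ℝ) i j) μ := by
  induction n generalizing i j with
  | zero => exact aemeasurable_const
  | succ n ih =>
    simp only [forwardProduct, Units.val_mul]
    refine aemeasurable_mul_apply (fun i j => ?_) ih i j
    rw [← Equiv.Perm.iterate_eq_pow]
    exact (hA i j).comp_quasiMeasurePreserving (hT.iterate n).quasiMeasurePreserving

theorem entrySum_forwardProduct_le {X : Type*} {d : ℕ} (T : Equiv.Perm X) (A : X → GL (Fin d) ℝ)
    (n : ℕ) (x : X) :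
    entrySum ((forwardProduct T A n x : GL (Fin d) ℝ) : Matrix (Fin d) (Fin d) ℝ) ≤
      entrySum (1 : Matrix (Fin d) (Fin d) ℝ) *
        ∏ k ∈ Finset.range n, entrySum (A ((T ^ k) x) : Matrix (Fin d) (Fin d) ℝ) := by
  induction n with
  | zero => simp [forwardProduct]
  | succ n ih =>
    rw [Finset.prod_range_succ, forwardProduct, Units.val_mul, ← mul_assoc, mul_comm _ (entrySum _)]
    exact (entrySum_mul_le _ _).trans (mul_le_mul_of_nonneg_left ih (entrySum_nonneg _))

/-- A cocycle conjugate into a Zimmer block has zero growth rate in mean. Gram–Schmidt applied to the columns of `α(x)⁻¹` gives orthogonal matrices `O(x)` for which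
`O(T^n x)ᵀ Aⁿ(x) O(x)` is block triangular, has norm comparable to that of `Aⁿ(x)`, and equals
`R(T^n x) uₙ(x) R(x)⁻¹` with `uₙ(x)` in the Zimmer block and `R(x)` upper triangular. -/
theorem exists_integral_log_opNorm_le {X : Type*} [MeasurableSpace X] {μ : Measure X}
    [IsProbabilityMeasure μ] {d k : ℕ} [Nonempty (Fin d)] {T : Equiv.Perm X}
    (hT : MeasurePreserving T μ μ) {A α : X → GL (Fin d) ℝ}
    (hA : ∀ i j, AEMeasurable (fun x => (A x : Matrix (Fin d) (Fin d) ℝ) i j) μ)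
    (hAint : Integrable (fun x => Real.log (opNorm (A x))) μ)
    (hα : ∀ i j, AEMeasurable (fun x => (α x : Matrix (Fin d) (Fin d) ℝ) i j) μ)
    (hαdet : ∀ x, |(α x : Matrix (Fin d) (Fin d) ℝ).det| = 1)
    {H : Subgroup (GL (Fin d) ℝ)} {b : Fin d → Fin k} (hb : Monotone b) {C : ℝ} (hC : 1 ≤ C)
    (hH : ∀ M ∈ H, (M : Matrix (Fin d) (Fin d) ℝ).BlockTriangular b ∧
        |(M : Matrix (Fin d) (Fin d) ℝ).det| = 1 ∧
        entrySum (blockDiagPart b (M : Matrix (Fin d) (Fin d) ℝ)) ≤ C)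
    (hconj : ∀ᵐ x ∂μ, α (T x) * A x * (α x)⁻¹ ∈ H) :
    (∀ n, 0 ≤ ∫ x, Real.log (opNorm (forwardProduct T A n x)) ∂μ) ∧
    ∀ ε : ℝ, 0 < ε → ∃ n : ℕ, 1 ≤ n ∧
      ∫ x, Real.log (opNorm (forwardProduct T A n x)) ∂μ ≤ ε * n := by
  set F : ℕ → X → Matrix (Fin d) (Fin d) ℝ := fun n x =>
    ((forwardProduct T A n x : GL (Fin d) ℝ) : Matrix (Fin d) (Fin d) ℝ)
  set β : X → Matrix (Fin d) (Fin d) ℝ := fun x => (α x : Matrix (Fin d) (Fin d) ℝ)⁻¹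
  set O : X → Matrix (Fin d) (Fin d) ℝ := fun x => orthFactor (β x)
  have hαu : ∀ x, IsUnit (α x : Matrix (Fin d) (Fin d) ℝ).det := fun x =>
    isUnit_iff_ne_zero.2 fun h => by simpa [h] using hαdet x
  have hβα : ∀ x, β x * (α x : Matrix (Fin d) (Fin d) ℝ) = 1 := fun x =>
    Matrix.nonsing_inv_mul _ (hαu x)
  have hβdet : ∀ x, |(β x).det| = 1 := fun x => by
    have h := congrArg Matrix.det (hβα x)
    rw [Matrix.det_mul, Matrix.det_one] at h
    have h' := congrArg abs h
    rwa [abs_mul, hαdet, mul_one, abs_one] at h'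
  have hβu : ∀ x, IsUnit (β x).det := fun x =>
    isUnit_iff_ne_zero.2 fun h => by simpa [h] using hβdet x
  have hOO : ∀ x, (O x)ᵀ * O x = 1 := fun x => orthFactor_transpose_mul_self (hβu x)
  have hOO' : ∀ x, O x * (O x)ᵀ = 1 := fun x => mul_eq_one_comm.1 (hOO x)
  have hOdet : ∀ x, |(O x).det| = 1 := fun x => abs_det_orthFactor (hβu x)
  have hOmeas : ∀ i j, AEMeasurable (fun x => O x i j) μ :=
    aemeasurable_orthFactor (aemeasurable_inv_apply hα)
  have hTn : ∀ n x, (T ^ n) x = T^[n] x := fun n x => by rw [Equiv.Perm.iterate_eq_pow]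
  have hTO : ∀ n i j, AEMeasurable (fun x => O (T^[n] x) i j) μ := fun n i j =>
    (hOmeas i j).comp_quasiMeasurePreserving (hT.iterate n).quasiMeasurePreserving
  have hFmeas := aemeasurable_forwardProduct_apply hT hA
  have hFadd : ∀ n m x, F (n + m) x = F n (T^[m] x) * F m x := fun n m x => by
    simp only [F]
    rw [forwardProduct_add, Units.val_mul, hTn]
  -- `u n` is the cocycle conjugated into the Zimmer block
  set u : ℕ → X → GL (Fin d) ℝ := fun n x => α (T^[n] x) * forwardProduct T A n x * (α x)⁻¹
  have hu : ∀ᵐ x ∂μ, ∀ n, u n x ∈ H := by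
    filter_upwards [ae_forall_iterate hT hconj] with x hx n
    have := conj_forwardProduct_mem (T := T) (A := A) (α := α) (H := H) (x := x)
      (fun k => by rw [hTn]; exact hx k) n
    rwa [hTn] at this
  have hFu : ∀ n x, F n x = β (T^[n] x) * (u n x : Matrix (Fin d) (Fin d) ℝ) *
      (α x : Matrix (Fin d) (Fin d) ℝ) := by
    intro n x
    have h : forwardProduct T A n x = (α (T^[n] x))⁻¹ * u n x * α x := by
      simp only [u]
      group
    simp only [F, h, Units.val_mul, β, Matrix.coe_units_inv]
  have hFdet : ∀ᵐ x ∂μ, ∀ n, |(F n x).det| = 1 := by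
    filter_upwards [hu] with x hx n
    rw [hFu, Matrix.det_mul, Matrix.det_mul, abs_mul, abs_mul, hβdet, hαdet, (hH _ (hx n)).2.1]
    norm_num
  have hopNorm : ∀ᵐ x ∂μ, ∀ n, 1 ≤ opNorm (forwardProduct T A n x) := by
    filter_upwards [hFdet] with x hx n using one_le_opNorm_of_abs_det _ (hx n)
  refine ⟨fun n => integral_nonneg_of_ae ?_, fun ε hε => ?_⟩
  · filter_upwards [hopNorm] with x hx using Real.log_nonneg (hx n)
  -- the triangular factors of the QR decomposition of `β` and their inverses
  set R : X → Matrix (Fin d) (Fin d) ℝ := fun x => (O x)ᵀ * β x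
  set S : X → Matrix (Fin d) (Fin d) ℝ := fun x => (α x : Matrix (Fin d) (Fin d) ℝ) * O x
  have hRS : ∀ x, R x * S x = 1 := fun x => by
    simp only [R, S]
    rw [Matrix.mul_assoc, ← Matrix.mul_assoc (β x), hβα, Matrix.one_mul, hOO]
  have hRtri : ∀ x, (R x).BlockTriangular b := fun x i j hij =>
    orthFactor_transpose_mul_apply_eq_zero (β x) (hb.reflect_lt hij)
  have hRdet : ∀ x, |(R x).det| = 1 := fun x => by
    simp only [R, Matrix.det_mul, Matrix.det_transpose, abs_mul, hOdet, hβdet, mul_one]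
  have hSdet : ∀ x, |(S x).det| = 1 := fun x => by
    simp only [S, Matrix.det_mul, abs_mul, hOdet, hαdet, mul_one]
  have hStri : ∀ x, (S x).BlockTriangular b := fun x => by
    have : Invertible (R x) := Matrix.invertibleOfIsUnitDet _
      (isUnit_iff_ne_zero.2 fun h => by simpa [h] using hRdet x)
    rw [← Matrix.inv_eq_right_inv (hRS x)]
    exact Matrix.blockTriangular_inv_of_blockTriangular (hRtri x)
  set B : ℕ → X → Matrix (Fin d) (Fin d) ℝ := fun n x => (O (T^[n] x))ᵀ * F n x * O x
  have hBmeas : ∀ n i j, AEMeasurable (fun x => B n x i j) μ := fun n =>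
    aemeasurable_mul_apply
      (aemeasurable_mul_apply (fun i j => hTO n j i) (hFmeas n)) hOmeas
  have hBmul : ∀ n m x, B (n + m) x = B n (T^[m] x) * B m x := fun n m x => by
    simp only [B]
    rw [hFadd n m x, Function.iterate_add_apply T n m x,
      show ∀ P Q Y Y' V Z : Matrix (Fin d) (Fin d) ℝ,
        P * Q * Y * (Y' * V * Z) = P * Q * (Y * Y') * V * Z from
        fun P Q Y Y' V Z => by simp only [Matrix.mul_assoc], hOO', Matrix.mul_one]
    simp only [Matrix.mul_assoc]
  have hBu : ∀ n x, B n x = R (T^[n] x) * (u n x : Matrix (Fin d) (Fin d) ℝ) * S x := fun n x => by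
    simp only [B, hFu, R, S, Matrix.mul_assoc]
  have hBtri : ∀ᵐ x ∂μ, ∀ n, (B n x).BlockTriangular b := by
    filter_upwards [hu] with x hx n
    rw [hBu]
    exact ((hRtri _).mul (hH _ (hx n)).1).mul (hStri x)
  have hBdet : ∀ᵐ x ∂μ, ∀ n, |(B n x).det| = 1 := by
    filter_upwards [hFdet] with x hx n
    simp only [B, Matrix.det_mul, Matrix.det_transpose, abs_mul, hOdet, hx n, mul_one]
  -- comparison of the norms of `B n x` and `F n x`
  set D : ℝ := d * (d * 1)
  have hd : 1 ≤ d := Fin.pos (Classical.arbitrary (Fin d))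
  have hD : 1 ≤ D := by
    have : (1 : ℝ) ≤ d := by exact_mod_cast hd
    simp only [D]
    nlinarith
  have hOD : ∀ x, entrySum (O x) ≤ D := fun x =>
    entrySum_le_of_abs_le (abs_orthFactor_le_one (hβu x))
  have hOtD : ∀ x, entrySum (O x)ᵀ ≤ D := fun x =>
    entrySum_le_of_abs_le fun i j => abs_orthFactor_le_one (hβu x) j i
  have hBF : ∀ n x, entrySum (B n x) ≤ D * entrySum (F n x) * D := fun n x =>
    (entrySum_mul_le _ _).trans (mul_le_mul ((entrySum_mul_le _ _).trans
      (mul_le_mul_of_nonneg_right (hOtD _) (entrySum_nonneg _))) (hOD x) (entrySum_nonneg _)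
      (mul_nonneg (by linarith) (entrySum_nonneg _)))
  have hFB : ∀ n x, entrySum (F n x) ≤ D * entrySum (B n x) * D := fun n x => by
    have h : F n x = O (T^[n] x) * B n x * (O x)ᵀ := by
      simp only [B]
      rw [show ∀ P Q Y V Z : Matrix (Fin d) (Fin d) ℝ,
        P * (Q * Y * V) * Z = (P * Q) * Y * (V * Z) from
        fun P Q Y V Z => by simp only [Matrix.mul_assoc], hOO', hOO', Matrix.mul_one,
        Matrix.one_mul]
    rw [h]
    exact (entrySum_mul_le _ _).trans (mul_le_mul ((entrySum_mul_le _ _).trans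
      (mul_le_mul_of_nonneg_right (hOD _) (entrySum_nonneg _))) (hOtD x) (entrySum_nonneg _)
      (mul_nonneg (by linarith) (entrySum_nonneg _)))
  set g : X → ℝ := fun x => Real.log (entrySum (A x : Matrix (Fin d) (Fin d) ℝ))
  have hAge : ∀ᵐ x ∂μ, 1 ≤ opNorm (A x) := by
    filter_upwards [hopNorm] with x hx
    simpa [forwardProduct] using hx 1
  have hg : Integrable g μ := by
    refine ((integrable_const (Real.log D)).add hAint).mono'
      (Real.measurable_log.comp_aemeasurable (aemeasurable_entrySum hA)).aestronglyMeasurable ?_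
    filter_upwards [hAge] with x hx
    have h1 := opNorm_le_entrySum (A x)
    rw [Real.norm_of_nonneg (Real.log_nonneg (hx.trans h1)), Pi.add_apply,
      ← Real.log_mul (by linarith) (by linarith)]
    refine Real.log_le_log (by linarith) ((entrySum_le_opNorm _).trans (le_of_eq ?_))
    simp only [D]
    ring
  have hlogB : ∀ᵐ x ∂μ, ∀ n, 0 ≤ Real.log (entrySum (B n x)) ∧ Real.log (entrySum (B n x)) ≤
      3 * Real.log D + ∑ k ∈ Finset.range n, g (T^[k] x) := by
    filter_upwards [hBdet, ae_forall_iterate hT hAge] with x hx hxA n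
    have h1 := one_le_entrySum_of_abs_det (hx n)
    refine ⟨Real.log_nonneg h1, ?_⟩
    have hpos : ∀ k ∈ Finset.range n,
        entrySum (A (T^[k] x) : Matrix (Fin d) (Fin d) ℝ) ≠ 0 := fun k _ => by
      have := (hxA k).trans (opNorm_le_entrySum _)
      linarith
    have hone : entrySum (1 : Matrix (Fin d) (Fin d) ℝ) ≤ D :=
      entrySum_le_of_abs_le fun i j => by
        rw [Matrix.one_apply]
        split_ifs <;> simp
    have hprod : 0 ≤ ∏ k ∈ Finset.range n,
        entrySum (A (T^[k] x) : Matrix (Fin d) (Fin d) ℝ) :=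
      Finset.prod_nonneg fun _ _ => entrySum_nonneg _
    have h2 : entrySum (F n x) ≤ D *
        ∏ k ∈ Finset.range n, entrySum (A (T^[k] x) : Matrix (Fin d) (Fin d) ℝ) := by
      have := entrySum_forwardProduct_le T A n x
      simp only [hTn] at this
      exact this.trans (mul_le_mul_of_nonneg_right hone hprod)
    have h3 : entrySum (B n x) ≤ D ^ 3 *
        ∏ k ∈ Finset.range n, entrySum (A (T^[k] x) : Matrix (Fin d) (Fin d) ℝ) := by
      refine (hBF n x).trans ?_
      have := mul_le_mul_of_nonneg_left h2 (show 0 ≤ D * D by positivity)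
      nlinarith
    refine (Real.log_le_log (by linarith) h3).trans (le_of_eq ?_)
    rw [Real.log_mul (by positivity) (Finset.prod_ne_zero_iff.2 hpos), Real.log_pow,
      Real.log_prod hpos]
    norm_num [g]
  have hTg : ∀ n, Integrable (fun x => ∑ k ∈ Finset.range n, g (T^[k] x)) μ := fun n =>
    integrable_finsetSum _ fun k _ => (hT.iterate k).integrable_comp_of_integrable hg
  have hBint : ∀ n, Integrable (fun x => Real.log (entrySum (B n x))) μ := by
    intro n
    refine ((integrable_const (3 * Real.log D)).add (hTg n)).mono'
      (Real.measurable_log.comp_aemeasurable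
        (aemeasurable_entrySum (hBmeas n))).aestronglyMeasurable ?_
    filter_upwards [hlogB] with x hx
    rw [Real.norm_of_nonneg (hx n).1]
    exact (hx n).2
  -- the block diagonal part grows sublinearly
  have hΔge : ∀ M : Matrix (Fin d) (Fin d) ℝ, M.BlockTriangular b → |M.det| = 1 →
      1 ≤ entrySum (blockDiagPart b M) := fun M hM hM' =>
    one_le_entrySum_of_abs_det (by rw [det_blockDiagPart hM, hM'])
  have hΔmeas : ∀ M : X → Matrix (Fin d) (Fin d) ℝ, (∀ i j, AEMeasurable (fun x => M x i j) μ) →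
      AEMeasurable (fun x => Real.log (entrySum (blockDiagPart b (M x)))) μ := by
    intro M hM
    refine Real.measurable_log.comp_aemeasurable (aemeasurable_entrySum fun i j => ?_)
    simp only [blockDiagPart, Matrix.of_apply]
    split_ifs
    · exact hM i j
    · exact aemeasurable_const
  have hRmeas := hΔmeas R
    (aemeasurable_mul_apply (fun i j => hOmeas j i) (aemeasurable_inv_apply hα))
  have hSmeas := hΔmeas S (aemeasurable_mul_apply hα hOmeas)
  obtain ⟨N, hN1, hN⟩ := exists_integral_le_of_birkhoff_bound hT hg
    (φ := fun x => Real.log (entrySum (blockDiagPart b (R x))))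
    (ψ := fun x => Real.log C + Real.log (entrySum (blockDiagPart b (S x))))
    hRmeas (aemeasurable_const.add hSmeas)
    (3 * Real.log D) (h := fun n x => Real.log (entrySum (blockDiagPart b (B n x))))
    (fun n => by
      filter_upwards [hBtri, hBdet] with x hx hx' using
        Real.log_nonneg (hΔge _ (hx n) (hx' n)))
    (fun n => by
      filter_upwards [hlogB, hBtri, hBdet] with x hx hx1 hx2
      have h1 := hΔge _ (hx1 n) (hx2 n)
      exact (Real.log_le_log (by linarith)
        (entrySum_mono (abs_blockDiagPart_le b _))).trans (hx n).2)
    (fun n => by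
      filter_upwards [hu, hBtri, hBdet] with x hx hx1 hx2
      have h1 := hΔge _ (hx1 n) (hx2 n)
      have hR := hΔge _ (hRtri (T^[n] x)) (hRdet _)
      have hS := hΔge _ (hStri x) (hSdet x)
      obtain ⟨t1, -, t3⟩ := hH _ (hx n)
      have h2 : entrySum (blockDiagPart b (B n x)) ≤
          entrySum (blockDiagPart b (R (T^[n] x))) * C * entrySum (blockDiagPart b (S x)) := by
        rw [hBu, blockDiagPart_mul ((hRtri _).mul t1) (hStri x), blockDiagPart_mul (hRtri _) t1]
        refine (entrySum_mul_le _ _).trans (mul_le_mul_of_nonneg_right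
          ((entrySum_mul_le _ _).trans ?_) (entrySum_nonneg _))
        exact mul_le_mul_of_nonneg_left t3 (entrySum_nonneg _)
      refine (Real.log_le_log (by linarith) h2).trans (le_of_eq ?_)
      rw [Real.log_mul (by positivity) (by linarith), Real.log_mul (by linarith) (by linarith),
        add_assoc])
    (show 0 < ε / 4 by positivity)
  obtain ⟨c, hc⟩ := exists_integral_log_entrySum_le_blockDiagPart hT hBmeas
    (ae_of_all _ fun x n m => hBmul n m x) hBtri hBdet hBint N (show 0 < ε / 4 by positivity)
  have hFint : ∀ n, ∫ x, Real.log (opNorm (forwardProduct T A n x)) ∂μ ≤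
      2 * Real.log D + ∫ x, Real.log (entrySum (B n x)) ∂μ := by
    intro n
    have h : ∫ x, Real.log (opNorm (forwardProduct T A n x)) ∂μ ≤
        ∫ x, (2 * Real.log D + Real.log (entrySum (B n x))) ∂μ := by
      refine integral_mono_of_nonneg ?_ ((integrable_const _).add (hBint n)) ?_
      · filter_upwards [hopNorm] with x hx using Real.log_nonneg (hx n)
      · filter_upwards [hopNorm, hBdet] with x hx hx'
        have h1 := one_le_entrySum_of_abs_det (hx' n)
        have h2 : opNorm (forwardProduct T A n x) ≤ D ^ 2 * entrySum (B n x) :=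
          ((opNorm_le_entrySum _).trans (hFB n x)).trans (le_of_eq (by ring))
        refine (Real.log_le_log (by linarith [hx n]) h2).trans (le_of_eq ?_)
        rw [Real.log_mul (by positivity) (by linarith), Real.log_pow]
        norm_num
    rw [integral_add (integrable_const _) (hBint n)] at h
    simpa using h
  obtain ⟨m, hm⟩ := exists_nat_ge ((2 * Real.log D + c) / (ε / 2))
  have hm' : 2 * Real.log D + c ≤ m * (ε / 2) := (div_le_iff₀ (by positivity)).1 hm
  refine ⟨(m + 1) * N, Nat.mul_pos m.succ_pos hN1, ?_⟩
  have e1 := hFint ((m + 1) * N)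
  have e2 := hc m
  have hm0 : (0 : ℝ) ≤ m := Nat.cast_nonneg m
  have hN1' : (1 : ℝ) ≤ N := by exact_mod_cast hN1
  push_cast
  have e3 : (m + 1 : ℝ) * (∫ x, Real.log (entrySum (blockDiagPart b (B N x))) ∂μ + ε / 4) ≤
      (m + 1) * (ε / 4 * N + ε / 4 * N) :=
    mul_le_mul_of_nonneg_left (by nlinarith) (by positivity)
  have e4 : m * (ε / 2) ≤ (m + 1) * (ε / 2 * N) :=
    mul_le_mul (by linarith) (le_mul_of_one_le_right (by positivity) hN1') (by positivity)
      (by positivity)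
  nlinarith

/-! ### The Lyapunov exponents -/

theorem iInf_coe_div_eq_zero {I : ℕ → ℝ} (h0 : ∀ n, 0 ≤ I n)
    (h : ∀ ε : ℝ, 0 < ε → ∃ n : ℕ, 1 ≤ n ∧ I n ≤ ε * n) :
    ⨅ (n : ℕ) (_ : 1 ≤ n), ((1 / (n : ℝ) * I n : ℝ) : EReal) = 0 := by
  refine le_antisymm (EReal.le_of_forall_lt_iff_le.1 fun ε hε => ?_)
    (le_iInf₂ fun n _ => by exact_mod_cast mul_nonneg (by positivity) (h0 n))
  obtain ⟨n, hn, hI⟩ := h ε (by exact_mod_cast hε)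
  refine iInf₂_le_of_le n hn (EReal.coe_le_coe_iff.2 ?_)
  have : (0 : ℝ) < n := by exact_mod_cast hn
  rw [one_div, inv_mul_le_iff₀ this]
  linarith

theorem iSup_coe_div_neg_eq_zero {I : ℕ → ℝ} (h0 : ∀ n, 0 ≤ I n)
    (h : ∀ ε : ℝ, 0 < ε → ∃ n : ℕ, 1 ≤ n ∧ I n ≤ ε * n) :
    ⨆ (n : ℕ) (_ : 1 ≤ n), ((1 / (n : ℝ) * -I n : ℝ) : EReal) = 0 := by
  refine le_antisymm (iSup₂_le fun n _ => ?_) (EReal.ge_of_forall_gt_iff_ge.1 fun ε hε => ?_)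
  · have : 1 / (n : ℝ) * -I n ≤ 0 :=
      mul_nonpos_of_nonneg_of_nonpos (by positivity) (neg_nonpos.2 (h0 n))
    exact_mod_cast this
  · have hε' : ε < 0 := by exact_mod_cast hε
    obtain ⟨n, hn, hI⟩ := h (-ε) (by linarith)
    refine le_iSup₂_of_le n hn (EReal.coe_le_coe_iff.2 ?_)
    have : (0 : ℝ) < n := by exact_mod_cast hn
    rw [one_div, le_inv_mul_iff₀ this]
    linarith

theorem opNorm_eq_zero_of_isEmpty {d : ℕ} [IsEmpty (Fin d)] (M : GL (Fin d) ℝ) : opNorm M = 0 :=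
  le_antisymm ((opNorm_le_entrySum M).trans (by simp [entrySum])) (norm_nonneg _)

theorem measurable_leftShift_inv {ℓ : ℕ} (Q : Matrix (Fin ℓ) (Fin ℓ) ℕ) :
    Measurable ((leftShift Q)⁻¹ : Equiv.Perm (SFT Q)) := by
  have h : Measurable fun x : SFT Q => fun n : ℤ => x.1 (n - 1) :=
    measurable_pi_lambda _ fun n => (measurable_pi_apply (n - 1)).comp measurable_subtype_coe
  exact h.subtype_mk (h := fun x => ((leftShift Q).symm x).2)

theorem measurePreserving_leftShift_inv {ℓ : ℕ} {Q : Matrix (Fin ℓ) (Fin ℓ) ℕ}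
    {μ : Measure (SFT Q)} (h : MeasurePreserving (leftShift Q) μ μ) :
    MeasurePreserving ((leftShift Q)⁻¹ : Equiv.Perm (SFT Q)) μ μ :=
  let e : SFT Q ≃ᵐ SFT Q := ⟨leftShift Q, h.measurable, measurable_leftShift_inv Q⟩
  MeasurePreserving.symm e h

theorem mainTheorem5 {ℓ d : ℕ} (Q : Matrix (Fin ℓ) (Fin ℓ) ℕ)
    (hQ : ∀ i j, Q i j = 0 ∨ Q i j = 1)
    (μ : Measure (SFT Q)) [IsProbabilityMeasure μ] (hμ : Ergodic (leftShift Q) μ)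
    (A : SFT Q → GL (Fin d) ℝ) (hA : ∀ i j, Measurable (fun x => (A x : Matrix (Fin d) (Fin d) ℝ) i j))
    (hAint : Integrable (fun x => Real.log (opNorm (A x))) μ)
    (hAinv : Integrable (fun x => Real.log (opNorm ((A x)⁻¹))) μ)
    (U : Set (GL (Fin d) ℝ)) (hU : IsZimmerBlock 0 U)
    (α : SFT Q → Matrix.SpecialLinearGroup (Fin d) ℝ)
    (hα : ∀ i j, AEMeasurable (fun x => (α x : Matrix (Fin d) (Fin d) ℝ) i j) μ)
    (hconj : ∀ᵐ x ∂μ,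
      (α (leftShift Q x) : GL (Fin d) ℝ) * A x * (α x : GL (Fin d) ℝ)⁻¹ ∈ U) :
    lyapunovPlus (leftShift Q) A μ = -lyapunovMinus (leftShift Q) A μ ∧
      lyapunovPlus (leftShift Q) A μ = 0 := by
  set T := leftShift Q
  have hT : MeasurePreserving T μ μ := hμ.toMeasurePreserving
  have hT' : MeasurePreserving (T⁻¹ : Equiv.Perm (SFT Q)) μ μ := measurePreserving_leftShift_inv hT
  have key : lyapunovPlus T A μ = 0 ∧ lyapunovMinus T A μ = 0 := by
    simp only [lyapunovPlus, lyapunovMinus, Real.log_inv, integral_neg, cocycle_neg_natCast]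
    rcases isEmpty_or_nonempty (Fin d) with hd | hd
    -- for `d = 0` the norm is `0`, and `Real.log 0 = 0`
    · simp only [opNorm_eq_zero_of_isEmpty, Real.log_zero, integral_zero]
      have h := fun ε : ℝ => fun hε : 0 < ε =>
        (⟨1, le_rfl, by simpa using hε.le⟩ : ∃ n : ℕ, 1 ≤ n ∧ (0 : ℝ) ≤ ε * n)
      exact ⟨iInf_coe_div_eq_zero (fun _ => le_rfl) h, iSup_coe_div_neg_eq_zero (fun _ => le_rfl) h⟩
    · obtain ⟨H, k, b, C, hHU, hb, hC, hH⟩ := hU.exists_subgroup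
      have hαdet : ∀ x, |((α x : GL (Fin d) ℝ) : Matrix (Fin d) (Fin d) ℝ).det| = 1 := fun x => by
        simp
      have hα' : ∀ i j, AEMeasurable
          (fun x => ((α x : GL (Fin d) ℝ) : Matrix (Fin d) (Fin d) ℝ) i j) μ := hα
      have hA' : ∀ i j, AEMeasurable
          (fun x => (A x : Matrix (Fin d) (Fin d) ℝ) i j) μ := fun i j => (hA i j).aemeasurable
      obtain ⟨h0, h1⟩ := exists_integral_log_opNorm_le hT hA' hAint hα' hαdet hb hC hH
        (hconj.mono fun x hx => (hHU _).2 hx)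
      obtain ⟨h2, h3⟩ := exists_integral_log_opNorm_le (A := fun y => (A (T⁻¹ y))⁻¹) hT'
        (fun i j => by
          simp only [Matrix.coe_units_inv]
          exact (aemeasurable_inv_apply hA' i j).comp_quasiMeasurePreserving
            hT'.quasiMeasurePreserving)
        (hT'.integrable_comp_of_integrable hAinv) hα' hαdet hb hC hH (by
          filter_upwards [hT'.quasiMeasurePreserving.ae hconj] with x hx
          have hx' := H.inv_mem ((hHU _).2 hx)
          rw [show T (T⁻¹ x) = x from T.apply_symm_apply x] at hx'
          convert hx' using 1
          group)
      exact ⟨iInf_coe_div_eq_zero h0 h1, iSup_coe_div_neg_eq_zero h2 h3⟩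
  rw [key.1, key.2]
  simp
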